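/- Let $d\ge 1$ be an integer and let $s\in(0,1]$. For $f\in\ell^1(\mathbb Z^d)$ and $\xi\in\mathbb T^d:=[-\pi,\pi]^d$ put $$\widehat f(\xi)=(2\pi)^{-d/2}\sum_{x\in\mathbb Z^d}f(x)e^{-i\langle x,\xi\rangle},\qquad \omega(\xi)=4\sum_{j=1}^d\sin^2(\xi_j/2),$$ let $(-\Delta)^s$ be the Fourier multiplier $\widehat{(-\Delta)^sf}=\omega^s\widehat f$, that is, $(-\Delta)^sf(x)=(2\pi)^{-d/2}\int_{\mathbb T^d}\omega(\xi)^s\widehat f(\xi)e^{i\langle x,\xi\rangle}\,d\xi$, and let $$G_t^{(s)}(x)=\frac1{(2\pi)^d}\int_{\mathbb T^d}e^{-t\omega(\xi)^s}e^{i\langle x,\xi\rangle}\,d\xi,\qquad x\in\mathbb Z^d.$$ Let $u_0\in\ell^1(\mathbb Z^d)$ (real- or complex-valued; no moment assumption) and $M=\sum_{x\in\mathbb Z^d}u_0(x)$. Then the Cauchy problem $$\partial_tu+(-\Delta)^su=0\quad(t>0),\qquad u(0)=u_0,$$ has a unique strong solution in $\ell^1(\mathbb Z^d)$ (that is, $u:[0,\infty)\to\ell^1(\mathbb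 Z^d)$ is continuous, and differentiable in the $\ell^1$ norm for $t>0$), and this solution satisfies $$\lim_{t\to\infty}\|u(t)-M\,G_t^{(s)}\|_{\ell^1(\mathbb Z^d)}=0\qquad\text{and}\qquad \lim_{t\to\infty}t^{\frac d{2s}}\|u(t)-M\,G_t^{(s)}\|_{\ell^\infty(\mathbb Z^d)}=0.$$ Consequently, for every $1\le p\le\infty$ (with $1/\infty=0$), $$\lim_{t\to\infty}t^{\frac d{2s}\left(1-\frac1p\right)}\|u(t)-M\,G_t^{(s)}\|_{\ell^p(\mathbb Z^d)}=0.$$ -/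

import Mathlib

open MeasureTheory Filter Topology
open scoped ENNReal

noncomputable section

namespace LatticeHeat

/-- The space `ℓ¹(ℤᵈ)` of absolutely summable functions on the lattice, with its norm. -/
abbrev Ell1 (d : ℕ) : Type := lp (fun _ : Fin d → ℤ => ℂ) 1

/-- The pairing `⟨x, ξ⟩ = ∑ⱼ xⱼ ξⱼ` of a lattice point and a frequency. -/
def pairing {d : ℕ} (x : Fin d → ℤ) (ξ : Fin d → ℝ) : ℝ := ∑ j, (x j : ℝ) * ξ j

/-- The frequency domain `𝕋ᵈ = [-π, π]ᵈ`. -/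
def torus (d : ℕ) : Set (Fin d → ℝ) := Set.Icc (fun _ => -Real.pi) (fun _ => Real.pi)

/-- The symbol `ω(ξ) = 4 ∑ⱼ sin²(ξⱼ / 2)` of the discrete Laplacian `-Δ`. -/
def symbol {d : ℕ} (ξ : Fin d → ℝ) : ℝ := 4 * ∑ j, Real.sin (ξ j / 2) ^ 2

/-- The Fourier transform `f̂(ξ) = (2π)^(-d/2) ∑ₓ f(x) e^{-i⟨x, ξ⟩}` of `f ∈ ℓ¹(ℤᵈ)`. -/
def fourier {d : ℕ} (f : Ell1 d) (ξ : Fin d → ℝ) : ℂ :=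
  (((2 * Real.pi) ^ (-(d : ℝ) / 2) : ℝ) : ℂ) *
    ∑' x : Fin d → ℤ, f x * Complex.exp (-(Complex.I * (pairing x ξ : ℂ)))

/-- The inverse transform `x ↦ (2π)^(-d/2) ∫_{𝕋ᵈ} g(ξ) e^{i⟨x, ξ⟩} dξ`. -/
def invFourier {d : ℕ} (g : (Fin d → ℝ) → ℂ) (x : Fin d → ℤ) : ℂ :=
  (((2 * Real.pi) ^ (-(d : ℝ) / 2) : ℝ) : ℂ) *
    ∫ ξ in torus d, g ξ * Complex.exp (Complex.I * (pairing x ξ : ℂ))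

/-- The fractional Laplacian `(-Δ)^s` on `ℓ¹(ℤᵈ)`: the Fourier multiplier with symbol `ω(ξ)^s`. -/
def fracLaplacian {d : ℕ} (s : ℝ) (f : Ell1 d) : (Fin d → ℤ) → ℂ :=
  invFourier (fun ξ => ((symbol ξ ^ s : ℝ) : ℂ) * fourier f ξ)

/-- The lattice fractional heat kernel
`G_t^{(s)}(x) = (2π)^(-d) ∫_{𝕋ᵈ} e^{-t ω(ξ)^s} e^{i⟨x, ξ⟩} dξ`. -/
def heatKernel {d : ℕ} (s t : ℝ) (x : Fin d → ℤ) : ℂ :=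
  ((((2 * Real.pi) ^ d)⁻¹ : ℝ) : ℂ) *
    ∫ ξ in torus d, ((Real.exp (-t * symbol ξ ^ s) : ℝ) : ℂ) *
      Complex.exp (Complex.I * (pairing x ξ : ℂ))

/-- `u` is a (strong) solution in `ℓ¹(ℤᵈ)` of `∂ₜ u + (-Δ)^s u = 0` for `t > 0`, `u(0) = u₀`.
Only the values `u t` with `t ≥ 0` matter. -/
structure IsSolution {d : ℕ} (s : ℝ) (u₀ : Ell1 d) (u : ℝ → Ell1 d) : Prop where
  initial : u 0 = u₀
  continuousOn : ContinuousOn u (Set.Ici 0)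
  equation : ∀ t : ℝ, 0 < t → ∃ v : Ell1 d, HasDerivAt u v t ∧
    ∀ x : Fin d → ℤ, v x + fracLaplacian s (u t) x = 0

/-- The mass `M = ∑ₓ u₀(x)`. -/
def mass {d : ℕ} (u₀ : Ell1 d) : ℂ := ∑' x : Fin d → ℤ, u₀ x

/-- The `ℓᵖ(ℤᵈ)` norm, `0 < p ≤ ∞`, with respect to the counting measure, with value `∞` on the
functions that do not belong to `ℓᵖ(ℤᵈ)`. -/
def ellNorm {d : ℕ} (p : ℝ≥0∞) (f : (Fin d → ℤ) → ℂ) : ℝ≥0∞ := eLpNorm f p Measure.count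

end LatticeHeat

end

/-! Let `P` average over the `2d` neighbours, so `-Δ = 2d(1 - P)`. For `0 < s ≤ 1` the series `1 -
(1 - x)^s = ∑ cₖ x^(k+1)` has `cₖ ≥ 0` and `∑ cₖ ≤ 1`. Hence `Q = ∑ cₖ P^(k+1)` is a contraction of
`ℓ¹`, and `(-Δ)^s = (2d)^s (1 - Q)` is bounded. Its exponential is a contraction semigroup, and
Grönwall's inequality gives uniqueness.

The `ℓ¹` limit is a coupling estimate in operator form. If `T` is a unit translation, `Q` equals
`(s/2d) T` plus an operator of norm at most `1 - s/2d`. So the semigroup is `exp(r(T - 1))`, with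
`r` proportional to `t`, times a commuting contraction. Poisson weights of mean `r` have standard
deviation `√r`, which yields `‖(1 - T) exp(r(T - 1))‖ ≤ 1/√r` (`norm_one_sub_mul_exp_le`).
Translations thus become invisible as `t → ∞`, first along the coordinate vectors and then along all
of `ℤᵈ`. Writing `u₀ - M δ₀ = ∑ u₀(y)(δ_y - δ₀)`, dominated convergence concludes without any moment
of `u₀`.

For `ℓ^∞`, half of the time is spent on the `ℓ¹` decay and half on the `ℓ¹ → ℓ^∞` bound of order
`t^(-d/2s)`, read off the Fourier representation. Interpolation gives every other `p`. -/

noncomputable section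

namespace LatticeHeat

/-! ### Exponentials of contractions in a Banach algebra -/

section BanachAlgebra

variable {A : Type*} [NormedRing A] [NormedAlgebra ℂ A]

theorem exp_smul_one (z : ℂ) :
    NormedSpace.exp (z • (1 : A)) = Complex.exp z • (1 : A) := by
  have := NormedSpace.algebraMap_exp_comm (𝕂 := ℂ) (𝔸 := A) z
  rw [Algebra.algebraMap_eq_smul_one, Algebra.algebraMap_eq_smul_one] at this
  rw [← this, Complex.exp_eq_exp_ℂ]

variable [CompleteSpace A]

theorem exp_add_eq_mul_of_commute {x y : A} (h : Commute x y) :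
    NormedSpace.exp (x + y) = NormedSpace.exp x * NormedSpace.exp y := by
  let _ : NormedAlgebra ℚ A := NormedAlgebra.restrictScalars ℚ ℂ A
  exact NormedSpace.exp_add_of_commute h

variable [NormOneClass A]

theorem norm_exp_le (x : A) : ‖NormedSpace.exp x‖ ≤ Real.exp ‖x‖ := by
  have h := NormedSpace.exp_series_hasSum_exp' (𝕂 := ℂ) x
  have hr := NormedSpace.exp_series_hasSum_exp' (𝕂 := ℝ) ‖x‖
  rw [← Real.exp_eq_exp_ℝ] at hr
  rw [← h.tsum_eq]
  refine tsum_of_norm_bounded hr fun n => ?_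
  rw [norm_smul, norm_inv, Complex.norm_natCast, smul_eq_mul]
  gcongr
  exact norm_pow_le x n

/-- Uniformization: `T - ρ` generates a contraction semigroup when `‖T‖ ≤ ρ`. -/
theorem norm_exp_smul_sub_le_one {T : A} {ρ t : ℝ} (hT : ‖T‖ ≤ ρ) (ht : 0 ≤ t) :
    ‖NormedSpace.exp ((t : ℂ) • (T - (ρ : ℂ) • (1 : A)))‖ ≤ 1 := by
  have h1 : (t : ℂ) • (T - (ρ : ℂ) • (1 : A))
      = (t : ℂ) • T + (((-(t * ρ) : ℝ)) : ℂ) • (1 : A) := by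
    rw [smul_sub, smul_smul]; push_cast; rw [neg_smul, sub_eq_add_neg]
  have hc : Commute ((t : ℂ) • T) ((((-(t * ρ) : ℝ)) : ℂ) • (1 : A)) :=
    (Commute.one_right _).smul_right _
  -- The scalar factor `e^(-tρ)` compensates the crude bound `e^(t‖T‖)`.
  rw [h1, exp_add_eq_mul_of_commute hc, exp_smul_one, mul_smul_comm, mul_one, norm_smul,
    ← Complex.ofReal_exp, Complex.norm_real, Real.norm_of_nonneg (Real.exp_pos _).le]
  calc Real.exp (-(t * ρ)) * ‖NormedSpace.exp ((t : ℂ) • T)‖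
      ≤ Real.exp (-(t * ρ)) * Real.exp (t * ρ) := by
        gcongr
        refine (norm_exp_le _).trans (Real.exp_le_exp.2 ?_)
        rw [norm_smul, Complex.norm_real, Real.norm_of_nonneg ht]
        gcongr
    _ = 1 := by rw [← Real.exp_add]; simp

theorem hasSum_poisson (r : ℝ) :
    HasSum (fun n : ℕ => r ^ n / n.factorial) (Real.exp r) := by
  rw [Real.exp_eq_exp_ℝ]
  exact NormedSpace.expSeries_div_hasSum_exp r

theorem hasSum_poisson_mean (r : ℝ) :
    HasSum (fun n : ℕ => (n : ℝ) * (r ^ n / n.factorial)) (r * Real.exp r) := by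
  rw [← hasSum_nat_add_iff' 1]
  simp only [Finset.range_one, Finset.sum_singleton, CharP.cast_eq_zero, zero_mul, sub_zero]
  convert! (hasSum_poisson r).mul_left r using 2 with n
  rw [Nat.factorial_succ]
  have : (n.factorial : ℝ) ≠ 0 := by positivity
  push_cast
  field_simp
  ring

/-- With the two previous sums, this gives the Poisson variance needed below. -/
theorem hasSum_poisson_sq (r : ℝ) :
    HasSum (fun n : ℕ => (n : ℝ) ^ 2 * (r ^ n / n.factorial)) ((r ^ 2 + r) * Real.exp r) := by
  rw [← hasSum_nat_add_iff' 1]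
  simp only [Finset.range_one, Finset.sum_singleton, CharP.cast_eq_zero, zero_mul, sub_zero,
    ne_eq, OfNat.ofNat_ne_zero, not_false_eq_true, zero_pow]
  have h := ((hasSum_poisson_mean r).add (hasSum_poisson r)).mul_left r
  convert! h using 1
  · funext n
    rw [Nat.factorial_succ]
    have : (n.factorial : ℝ) ≠ 0 := by positivity
    push_cast
    field_simp
    ring
  · ring

/-- The Poisson semigroup of a contraction `T` asymptotically annihilates the range of `1 - T`. -/
theorem norm_one_sub_mul_exp_le {T : A} (hT : ‖T‖ ≤ 1) {r : ℝ} (hr : 0 < r) :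
    ‖(1 - T) * NormedSpace.exp ((r : ℂ) • (T - 1))‖ ≤ 1 / Real.sqrt r := by
  have h1 : (r : ℂ) • (T - 1) = (r : ℂ) • T + (((-r : ℝ)) : ℂ) • (1 : A) := by
    rw [smul_sub]; push_cast; rw [neg_smul, sub_eq_add_neg]
  have hc : Commute ((r : ℂ) • T) ((((-r : ℝ)) : ℂ) • (1 : A)) :=
    (Commute.one_right _).smul_right _
  rw [h1, exp_add_eq_mul_of_commute hc, exp_smul_one, mul_smul_comm, mul_one, mul_smul_comm, norm_smul,
    ← Complex.ofReal_exp, Complex.norm_real, Real.norm_of_nonneg (Real.exp_pos _).le]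
  have hE : HasSum (fun n : ℕ => ((r ^ n / n.factorial : ℝ) : ℂ) • T ^ n)
      (NormedSpace.exp ((r : ℂ) • T)) := by
    convert! NormedSpace.exp_series_hasSum_exp' (𝕂 := ℂ) ((r : ℂ) • T) using 2 with n
    rw [smul_pow, smul_smul]; push_cast; congr 1; ring
  -- Multiplication by `T` shifts the index: `r^(n-1)/(n-1)! = (n/r) r^n/n!`, and the factor `n`
  -- covers `n = 0`.
  have hTE : HasSum (fun n : ℕ => (((n : ℝ) / r * (r ^ n / n.factorial) : ℝ) : ℂ) • T ^ n)
      (T * NormedSpace.exp ((r : ℂ) • T)) := by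
    rw [← hasSum_nat_add_iff' 1]
    simp only [Finset.range_one, Finset.sum_singleton, CharP.cast_eq_zero, zero_mul, zero_div,
      Complex.ofReal_zero, zero_smul, sub_zero]
    convert! hE.mul_left T using 2 with n
    rw [mul_smul_comm, ← pow_succ']
    congr 2
    rw [Nat.factorial_succ]
    have : (n.factorial : ℝ) ≠ 0 := by positivity
    push_cast
    field_simp
    ring
  have hD : HasSum (fun n : ℕ => (((1 - (n : ℝ) / r) * (r ^ n / n.factorial) : ℝ) : ℂ) • T ^ n)
      ((1 - T) * NormedSpace.exp ((r : ℂ) • T)) := by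
    rw [sub_mul, one_mul]
    convert! hE.sub hTE using 2 with n
    rw [← sub_smul]; push_cast; congr 1; ring
  have hs : 0 < Real.sqrt r := Real.sqrt_pos.2 hr
  have hss : Real.sqrt r ^ 2 = r := Real.sq_sqrt hr.le
  -- This majorant replaces Cauchy–Schwarz: `|g| ≤ (√r g² + 1/√r)/2` with `g = 1 - n/r`. As `g²` has
  -- Poisson mean `1/r`, both halves contribute equally and the total is `1/√r`, up to the factor
  -- `e^r`.
  have hB : HasSum (fun n : ℕ => (Real.sqrt r * (1 - (n : ℝ) / r) ^ 2 + 1 / Real.sqrt r) / 2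
      * (r ^ n / n.factorial)) (Real.exp r / Real.sqrt r) := by
    have h := (((hasSum_poisson r).mul_left ((Real.sqrt r + 1 / Real.sqrt r) / 2)).sub
      ((hasSum_poisson_mean r).mul_left (Real.sqrt r / r))).add
      ((hasSum_poisson_sq r).mul_left (Real.sqrt r / (2 * r ^ 2)))
    convert! h using 1
    · funext n; field_simp; ring
    · field_simp; rw [hss]; ring
  have hbound : ‖(1 - T) * NormedSpace.exp ((r : ℂ) • T)‖ ≤ Real.exp r / Real.sqrt r := by
    rw [← hD.tsum_eq]
    refine tsum_of_norm_bounded hB fun n => ?_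
    rw [norm_smul, Complex.norm_real, norm_mul, Real.norm_eq_abs,
      Real.norm_of_nonneg (by positivity : 0 ≤ r ^ n / n.factorial)]
    have hp : ‖T ^ n‖ ≤ 1 := (norm_pow_le T n).trans (pow_le_one₀ (norm_nonneg _) hT)
    have hg : |1 - (n : ℝ) / r| ≤ (Real.sqrt r * (1 - (n : ℝ) / r) ^ 2 + 1 / Real.sqrt r) / 2 := by
      rw [← sq_abs (1 - (n : ℝ) / r)]
      set g := |1 - (n : ℝ) / r|
      have : (Real.sqrt r * g ^ 2 + 1 / Real.sqrt r) / 2 - g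
          = (Real.sqrt r * g - 1) ^ 2 / (2 * Real.sqrt r) := by
        field_simp; ring
      have h2 : 0 ≤ (Real.sqrt r * g - 1) ^ 2 / (2 * Real.sqrt r) := by positivity
      linarith
    calc _ ≤ |1 - (n : ℝ) / r| * (r ^ n / n.factorial) * 1 := by gcongr
      _ ≤ _ := by rw [mul_one]; gcongr
  calc Real.exp (-r) * ‖(1 - T) * NormedSpace.exp ((r : ℂ) • T)‖
      ≤ Real.exp (-r) * (Real.exp r / Real.sqrt r) := by gcongr
    _ = 1 / Real.sqrt r := by rw [← mul_div_assoc, ← Real.exp_add]; simp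

end BanachAlgebra

/-! ### Positivity and summability of the binomial coefficients -/

section Binomial

/-- The coefficients of `1 - (1 - x)^s = ∑ₖ cₖ x^(k+1)`. -/
def fracCoeff (s : ℝ) (k : ℕ) : ℝ := (-1) ^ k * Ring.choose s (k + 1)

theorem choose_succ_mul (s : ℝ) (k : ℕ) :
    Ring.choose s (k + 1) * (k + 1) = Ring.choose s k * (s - k) := by
  rw [Ring.choose_eq_smul, Ring.choose_eq_smul, descPochhammer_succ_right, Nat.factorial_succ]
  have : (k.factorial : ℝ) ≠ 0 := by positivity
  simp only [Polynomial.smeval_mul, Polynomial.smeval_sub, Polynomial.smeval_X,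
    Polynomial.smeval_natCast, smul_eq_mul]
  push_cast
  field_simp
  simp

theorem fracCoeff_zero (s : ℝ) : fracCoeff s 0 = s := by
  simp [fracCoeff]

theorem fracCoeff_succ (s : ℝ) (k : ℕ) :
    fracCoeff s (k + 1) = fracCoeff s k * ((k + 1 - s) / (k + 2)) := by
  have h := choose_succ_mul s (k + 1)
  unfold fracCoeff
  push_cast at h
  have h2 : (k : ℝ) + 2 ≠ 0 := by positivity
  field_simp
  rw [pow_succ]
  linear_combination (-1) ^ k * (-1) * h

/-- The ratio `(k+1-s)/(k+2)` of consecutive coefficients is nonnegative because `s ≤ 1`. -/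
theorem fracCoeff_nonneg {s : ℝ} (hs0 : 0 ≤ s) (hs1 : s ≤ 1) (k : ℕ) : 0 ≤ fracCoeff s k := by
  induction k with
  | zero => rwa [fracCoeff_zero]
  | succ k ih =>
    rw [fracCoeff_succ]
    have : (0 : ℝ) ≤ k := by positivity
    exact mul_nonneg ih (div_nonneg (by linarith) (by linarith))

theorem hasSum_fracCoeff_mul_pow_of_lt {s x : ℝ} (hx : |x| < 1) :
    HasSum (fun k => fracCoeff s k * x ^ (k + 1)) (1 - (1 - x) ^ s) := by
  have h := (Real.one_add_rpow_hasFPowerSeriesOnBall_zero (a := s)).hasSum (y := -x)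
    (by simpa [enorm_eq_nnnorm] using! hx)
  simp only [binomialSeries_apply, List.ofFn_const, List.prod_replicate, smul_eq_mul,
    zero_add] at h
  rw [← hasSum_nat_add_iff' 1] at h
  simp only [Finset.range_one, Finset.sum_singleton, Ring.choose_zero_right, pow_zero,
    mul_one] at h
  convert! h.neg using 1
  · funext k
    rw [fracCoeff, neg_pow x, pow_succ (-1 : ℝ)]; ring
  · rw [← sub_eq_add_neg]; ring

/-- For `0 < x < 1`, positivity bounds every partial sum at `x` by `1 - (1 - x)^s ≤ 1`; then `x`
tends to `1`. -/
theorem sum_fracCoeff_le_one {s : ℝ} (hs0 : 0 ≤ s) (hs1 : s ≤ 1) (F : Finset ℕ) :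
    ∑ k ∈ F, fracCoeff s k ≤ 1 := by
  have hc : Tendsto (fun x : ℝ => ∑ k ∈ F, fracCoeff s k * x ^ (k + 1)) (𝓝[<] 1)
      (𝓝 (∑ k ∈ F, fracCoeff s k * 1 ^ (k + 1))) :=
    (Continuous.tendsto (by fun_prop) 1).mono_left nhdsWithin_le_nhds
  simp only [one_pow, mul_one] at hc
  refine le_of_tendsto hc ?_
  filter_upwards [Ioo_mem_nhdsLT (show (0 : ℝ) < 1 by norm_num)] with x hx
  have h := hasSum_fracCoeff_mul_pow_of_lt (s := s) (x := x) (by rw [abs_of_pos hx.1]; exact hx.2)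
  refine (sum_le_hasSum F (fun k _ => mul_nonneg (fracCoeff_nonneg hs0 hs1 k)
    (pow_nonneg hx.1.le _)) h).trans ?_
  have : 0 ≤ (1 - x) ^ s := Real.rpow_nonneg (by linarith [hx.2]) _
  linarith

theorem summable_fracCoeff {s : ℝ} (hs0 : 0 ≤ s) (hs1 : s ≤ 1) : Summable (fracCoeff s) :=
  summable_of_sum_le (fracCoeff_nonneg hs0 hs1) (sum_fracCoeff_le_one hs0 hs1)

theorem tsum_fracCoeff_le_one {s : ℝ} (hs0 : 0 ≤ s) (hs1 : s ≤ 1) : ∑' k, fracCoeff s k ≤ 1 :=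
  (summable_fracCoeff hs0 hs1).tsum_le_of_sum_le (sum_fracCoeff_le_one hs0 hs1)

/-- The endpoints matter: the symbol of `P` equals `1` at `ξ = 0` and `-1` at `ξ = (π, …, π)`. Both
sides are continuous on `[-1, 1]`, the right one because `s > 0`, and agree on the dense interior.
-/
theorem hasSum_fracCoeff_mul_pow {s x : ℝ} (hs0 : 0 < s) (hs1 : s ≤ 1) (hx : |x| ≤ 1) :
    HasSum (fun k => fracCoeff s k * x ^ (k + 1)) (1 - (1 - x) ^ s) := by
  have hbd : ∀ (k : ℕ) (y : ℝ), y ∈ Set.Icc (-1 : ℝ) 1 →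
      ‖fracCoeff s k * y ^ (k + 1)‖ ≤ fracCoeff s k := fun k y hy => by
    rw [norm_mul, norm_pow, Real.norm_of_nonneg (fracCoeff_nonneg hs0.le hs1 k)]
    exact mul_le_of_le_one_right (fracCoeff_nonneg hs0.le hs1 k)
      (pow_le_one₀ (norm_nonneg _) (abs_le.2 hy))
  have hcont : ContinuousOn (fun y : ℝ => ∑' k, fracCoeff s k * y ^ (k + 1)) (Set.Icc (-1) 1) :=
    continuousOn_tsum (fun k => by fun_prop) (summable_fracCoeff hs0.le hs1) hbd
  have hcont' : ContinuousOn (fun y : ℝ => 1 - (1 - y) ^ s) (Set.Icc (-1) 1) :=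
    (continuous_const.sub ((continuous_const.sub continuous_id).rpow_const
      fun _ => Or.inr hs0.le)).continuousOn
  have heq : Set.EqOn (fun y : ℝ => ∑' k, fracCoeff s k * y ^ (k + 1))
      (fun y : ℝ => 1 - (1 - y) ^ s) (Set.Icc (-1) 1) := by
    refine Set.EqOn.of_subset_closure (s := Set.Ioo (-1 : ℝ) 1) (fun y hy => ?_) hcont hcont'
      Set.Ioo_subset_Icc_self (by rw [closure_Ioo (by norm_num)])
    exact (hasSum_fracCoeff_mul_pow_of_lt (abs_lt.2 hy)).tsum_eq
  have hx' := abs_le.1 hx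
  rw [show 1 - (1 - x) ^ s = _ from (heq hx').symm]
  exact (Summable.of_norm_bounded (summable_fracCoeff hs0.le hs1)
    fun k => hbd k x hx').hasSum

end Binomial

/-! ### The subordinate of a contraction -/

section FracPower

variable {A : Type*} [NormedRing A] [NormedAlgebra ℂ A] [NormOneClass A]

/-- The subordinate `1 - (1 - P)^s = ∑ₖ cₖ P^(k+1)` of a contraction `P`. -/
def subordinate (s : ℝ) (P : A) : A := ∑' k, (fracCoeff s k : ℂ) • P ^ (k + 1)

variable {s : ℝ} {P : A}

theorem norm_fracCoeff_smul_pow_le (hs0 : 0 ≤ s) (hs1 : s ≤ 1) (hP : ‖P‖ ≤ 1) (k : ℕ) :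
    ‖(fracCoeff s k : ℂ) • P ^ (k + 1)‖ ≤ fracCoeff s k := by
  rw [norm_smul, Complex.norm_real, Real.norm_of_nonneg (fracCoeff_nonneg hs0 hs1 k)]
  exact mul_le_of_le_one_right (fracCoeff_nonneg hs0 hs1 k)
    ((norm_pow_le _ _).trans (pow_le_one₀ (norm_nonneg _) hP))

theorem norm_subordinate_le_one (hs0 : 0 ≤ s) (hs1 : s ≤ 1) (hP : ‖P‖ ≤ 1) :
    ‖subordinate s P‖ ≤ 1 :=
  (tsum_of_norm_bounded (summable_fracCoeff hs0 hs1).hasSum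
    (norm_fracCoeff_smul_pow_le hs0 hs1 hP)).trans (tsum_fracCoeff_le_one hs0 hs1)

variable [CompleteSpace A]

theorem hasSum_subordinate (hs0 : 0 ≤ s) (hs1 : s ≤ 1) (hP : ‖P‖ ≤ 1) :
    HasSum (fun k => (fracCoeff s k : ℂ) • P ^ (k + 1)) (subordinate s P) :=
  (Summable.of_norm_bounded (summable_fracCoeff hs0 hs1)
    (norm_fracCoeff_smul_pow_le hs0 hs1 hP)).hasSum

/-- The leading coefficient is `s`, so the others sum to at most `1 - s`. This isolates a definite
share of `P` inside the subordinate. -/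
theorem norm_subordinate_sub_le (hs0 : 0 ≤ s) (hs1 : s ≤ 1) (hP : ‖P‖ ≤ 1) :
    ‖subordinate s P - (s : ℂ) • P‖ ≤ 1 - s := by
  have h := (hasSum_nat_add_iff' (f := fun k => (fracCoeff s k : ℂ) • P ^ (k + 1)) 1).2
    (hasSum_subordinate hs0 hs1 hP)
  have h' := (hasSum_nat_add_iff' 1).2 (summable_fracCoeff hs0 hs1).hasSum
  simp only [Finset.range_one, Finset.sum_singleton, fracCoeff_zero, zero_add, pow_one] at h h'
  rw [← h.tsum_eq]
  refine (tsum_of_norm_bounded h' fun k => norm_fracCoeff_smul_pow_le hs0 hs1 hP _).trans ?_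
  linarith [tsum_fracCoeff_le_one hs0 hs1]

theorem commute_subordinate (hs0 : 0 ≤ s) (hs1 : s ≤ 1) (hP : ‖P‖ ≤ 1) {T : A}
    (h : Commute T P) : Commute T (subordinate s P) := by
  have hs := hasSum_subordinate hs0 hs1 hP
  have h1 := hs.mul_left T
  have h2 := hs.mul_right T
  refine h1.unique ?_
  convert! h2 using 2 with k
  exact ((h.pow_right _).smul_right _).eq

end FracPower

/-! ### Power series of an operator against an eigenfunctional -/

section Intertwining

variable {E : Type*} [NormedAddCommGroup E] [NormedSpace ℂ E]
  {X : E →L[ℂ] E} {Λ : E →L[ℂ] ℂ} {m : ℂ}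

theorem eigenfunctional_pow (h : ∀ f, Λ (X f) = m * Λ f) (n : ℕ) (f : E) :
    Λ ((X ^ n) f) = m ^ n * Λ f := by
  induction n with
  | zero => simp
  | succ n ih =>
    rw [pow_succ', mul_apply_eq_comp, h, ih, pow_succ']
    ring

variable [CompleteSpace E]

/-- A continuous functional passes through the exponential series term by term. Applied to
characters, this computes Fourier symbols without a functional calculus. -/
theorem eigenfunctional_exp (h : ∀ f, Λ (X f) = m * Λ f) (f : E) :
    Λ (NormedSpace.exp X f) = Complex.exp m * Λ f := by
  have h1 := (Λ ∘L ContinuousLinearMap.apply ℂ E f).hasSum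
    (NormedSpace.exp_series_hasSum_exp' (𝕂 := ℂ) X)
  have h2 := (NormedSpace.exp_series_hasSum_exp' (𝕂 := ℂ) m).mul_right (Λ f)
  rw [← Complex.exp_eq_exp_ℂ] at h2
  refine HasSum.unique ?_ h2
  convert! h1 using 2 with n
  rw [smul_eq_mul, mul_assoc, ← eigenfunctional_pow h n f]
  simp

variable [Nontrivial E]

theorem eigenfunctional_subordinate {s x : ℝ} (hs0 : 0 < s) (hs1 : s ≤ 1) (hX : ‖X‖ ≤ 1)
    (hx : |x| ≤ 1) (h : ∀ f, Λ (X f) = (x : ℂ) * Λ f) (f : E) :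
    Λ (subordinate s X f) = ((1 - (1 - x) ^ s : ℝ) : ℂ) * Λ f := by
  have h1 := (Λ ∘L ContinuousLinearMap.apply ℂ E f).hasSum
    (hasSum_subordinate hs0.le hs1 hX)
  have h2 := (Complex.hasSum_ofReal.2 (hasSum_fracCoeff_mul_pow hs0 hs1 hx)).mul_right (Λ f)
  refine HasSum.unique ?_ h2
  convert! h1 using 2 with n
  rw [Complex.ofReal_mul, Complex.ofReal_pow, mul_assoc, ← eigenfunctional_pow h (n + 1) f]
  simp

end Intertwining

/-! ### Translations, characters and averaging on `ℓ¹(ℤᵈ)` -/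

variable {d : ℕ}

/-- Needed so that the identity operator has norm one. -/
instance : Nontrivial (Ell1 d) :=
  ⟨lp.single 1 0 1, 0, fun h => by
    have := congrArg (fun f : Ell1 d => f 0) h
    simp at this⟩

theorem summable_norm (f : Ell1 d) : Summable fun x => ‖f x‖ := by
  simpa using (lp.memℓp f).summable (by simp)

theorem norm_eq_tsum (f : Ell1 d) : ‖f‖ = ∑' x, ‖f x‖ := by
  simpa using lp.norm_eq_tsum_rpow (by simp) f

theorem memℓp_comp_sub (f : Ell1 d) (y : Fin d → ℤ) :
    Memℓp (E := fun _ : Fin d → ℤ => ℂ) (fun x => f (x - y)) 1 := by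
  refine memℓp_gen ?_
  simpa [Function.comp_def] using (Equiv.subRight y).summable_iff.2 (summable_norm f)

/-- Translation `f ↦ f (· - y)` on `ℓ¹(ℤᵈ)`. -/
def translate (y : Fin d → ℤ) : Ell1 d →L[ℂ] Ell1 d :=
  LinearMap.mkContinuous
    { toFun := fun f => ⟨fun x => f (x - y), memℓp_comp_sub f y⟩
      map_add' := fun f g => by ext x; rfl
      map_smul' := fun c f => by ext x; rfl } 1 fun f => by
    rw [one_mul, norm_eq_tsum, norm_eq_tsum]
    exact ((Equiv.subRight y).tsum_eq fun x => ‖f x‖).le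

@[simp]
theorem translate_apply (y : Fin d → ℤ) (f : Ell1 d) (x : Fin d → ℤ) :
    translate y f x = f (x - y) := rfl

theorem norm_translate_le (y : Fin d → ℤ) : ‖translate y‖ ≤ 1 :=
  LinearMap.mkContinuous_norm_le _ zero_le_one _

theorem translate_zero : translate (0 : Fin d → ℤ) = 1 := by
  ext f x
  simp

theorem translate_add (y z : Fin d → ℤ) : translate (y + z) = translate y * translate z := by
  ext f x
  simp [sub_sub]

theorem commute_translate (y z : Fin d → ℤ) : Commute (translate y) (translate z) := by
  rw [commute_iff_eq, ← translate_add, ← translate_add, add_comm]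

theorem norm_mul_exp_pairing (f : Ell1 d) (ξ : Fin d → ℝ) (x : Fin d → ℤ) :
    ‖f x * Complex.exp (-(Complex.I * (pairing x ξ : ℂ)))‖ = ‖f x‖ := by
  rw [norm_mul, Complex.norm_exp]; simp

theorem summable_mul_exp_pairing (f : Ell1 d) (ξ : Fin d → ℝ) :
    Summable fun x => f x * Complex.exp (-(Complex.I * (pairing x ξ : ℂ))) :=
  Summable.of_norm (by simpa only [norm_mul_exp_pairing] using summable_norm f)

theorem norm_tsum_mul_exp_pairing_le (f : Ell1 d) (ξ : Fin d → ℝ) :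
    ‖∑' x, f x * Complex.exp (-(Complex.I * (pairing x ξ : ℂ)))‖ ≤ ‖f‖ := by
  rw [norm_eq_tsum]
  exact tsum_of_norm_bounded (summable_norm f).hasSum fun x => (norm_mul_exp_pairing f ξ x).le

/-- The unnormalized Fourier transform at the frequency `ξ` as a functional on `ℓ¹(ℤᵈ)`. -/
def charSum (ξ : Fin d → ℝ) : Ell1 d →L[ℂ] ℂ :=
  LinearMap.mkContinuous
    { toFun := fun f => ∑' x, f x * Complex.exp (-(Complex.I * (pairing x ξ : ℂ)))
      map_add' := fun f g => by
        rw [← (summable_mul_exp_pairing f ξ).tsum_add (summable_mul_exp_pairing g ξ)]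
        refine tsum_congr fun x => ?_
        rw [← add_mul]; rfl
      map_smul' := fun c f => by
        rw [RingHom.id_apply, smul_eq_mul, ← tsum_mul_left]
        refine tsum_congr fun x => ?_
        rw [← mul_assoc]; rfl } 1 fun f => by
    rw [one_mul]
    exact norm_tsum_mul_exp_pairing_le f ξ

theorem charSum_apply (ξ : Fin d → ℝ) (f : Ell1 d) :
    charSum ξ f = ∑' x, f x * Complex.exp (-(Complex.I * (pairing x ξ : ℂ))) := rfl

theorem norm_charSum_le (ξ : Fin d → ℝ) (f : Ell1 d) : ‖charSum ξ f‖ ≤ ‖f‖ :=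
  norm_tsum_mul_exp_pairing_le f ξ

theorem pairing_add (x y : Fin d → ℤ) (ξ : Fin d → ℝ) :
    pairing (x + y) ξ = pairing x ξ + pairing y ξ := by
  simp [pairing, add_mul, Finset.sum_add_distrib]

theorem charSum_translate (ξ : Fin d → ℝ) (y : Fin d → ℤ) (f : Ell1 d) :
    charSum ξ (translate y f) = Complex.exp (-(Complex.I * (pairing y ξ : ℂ))) * charSum ξ f := by
  rw [charSum_apply, charSum_apply, ← tsum_mul_left, ← (Equiv.addRight y).tsum_eq]
  refine tsum_congr fun x => ?_
  simp only [Equiv.coe_addRight, translate_apply, add_sub_cancel_right, pairing_add]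
  push_cast
  rw [mul_add, neg_add, Complex.exp_add]
  ring

/-- The averaging operator over the `2d` nearest neighbours. -/
def average (d : ℕ) : Ell1 d →L[ℂ] Ell1 d :=
  (((2 * d : ℝ)⁻¹ : ℝ) : ℂ) •
    ∑ j : Fin d, (translate (Pi.single j 1) + translate (-Pi.single j 1))

theorem norm_neighbours_sub_le (j : Fin d) :
    ‖(∑ i : Fin d, (translate (Pi.single i 1) + translate (-Pi.single i 1)))
      - translate (Pi.single j (1 : ℤ))‖ ≤ 2 * d - 1 := by
  have h2 : ∀ i : Fin d, ‖translate (Pi.single i (1 : ℤ)) + translate (-Pi.single i 1)‖ ≤ 2 :=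
    fun i => (norm_add_le _ _).trans (by
      linarith [norm_translate_le (Pi.single i (1 : ℤ)), norm_translate_le (-Pi.single i (1 : ℤ))])
  -- Cancelling one translation leaves its opposite and `d - 1` pairs, hence `2d - 1` contractions.
  rw [← Finset.add_sum_erase _ _ (Finset.mem_univ j), add_sub_right_comm, add_sub_cancel_left]
  refine (norm_add_le _ _).trans ?_
  have h3 : ‖∑ i ∈ Finset.univ.erase j,
      (translate (Pi.single i (1 : ℤ)) + translate (-Pi.single i 1))‖ ≤ (d - 1) * 2 := by
    refine (norm_sum_le_of_le _ fun i _ => h2 i).trans ?_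
    have : 1 ≤ d := Fin.pos j
    simp [Finset.card_erase_of_mem, Nat.cast_sub this]
  linarith [norm_translate_le (-Pi.single j (1 : ℤ))]

theorem norm_average_sub_le (j : Fin d) :
    ‖average d - (((2 * d : ℝ)⁻¹ : ℝ) : ℂ) • translate (Pi.single j 1)‖ ≤ 1 - (2 * d : ℝ)⁻¹ := by
  have hd : (0 : ℝ) < d := by exact_mod_cast Fin.pos j
  rw [average, ← smul_sub, norm_smul, Complex.norm_real, Real.norm_of_nonneg (by positivity)]
  calc _ ≤ (2 * d : ℝ)⁻¹ * (2 * d - 1) := by gcongr; exact norm_neighbours_sub_le j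
    _ = _ := by field_simp

theorem norm_average_le (hd : 1 ≤ d) : ‖average d‖ ≤ 1 := by
  have h := norm_average_sub_le (⟨0, hd⟩ : Fin d)
  have hd' : (0 : ℝ) < d := by exact_mod_cast hd
  have h2 : ‖(((2 * d : ℝ)⁻¹ : ℝ) : ℂ) • translate (Pi.single (⟨0, hd⟩ : Fin d) (1 : ℤ))‖
      ≤ (2 * d : ℝ)⁻¹ := by
    rw [norm_smul, Complex.norm_real, Real.norm_of_nonneg (by positivity)]
    exact mul_le_of_le_one_right (by positivity) (norm_translate_le _)
  have h3 := norm_add_le (average d - (((2 * d : ℝ)⁻¹ : ℝ) : ℂ) •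
    translate (Pi.single (⟨0, hd⟩ : Fin d) (1 : ℤ)))
    ((((2 * d : ℝ)⁻¹ : ℝ) : ℂ) • translate (Pi.single (⟨0, hd⟩ : Fin d) (1 : ℤ)))
  rw [sub_add_cancel] at h3
  linarith

theorem commute_translate_average (y : Fin d → ℤ) : Commute (translate y) (average d) :=
  (Commute.sum_right _ _ _ fun _ _ =>
    (commute_translate _ _).add_right (commute_translate _ _)).smul_right _

theorem pairing_single (j : Fin d) (n : ℤ) (ξ : Fin d → ℝ) :
    pairing (Pi.single j n) ξ = n * ξ j := by
  rw [pairing, Finset.sum_eq_single j]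
  · simp
  · intro i _ hi; simp [hi]
  · simp

theorem symbol_nonneg (ξ : Fin d → ℝ) : 0 ≤ symbol ξ := by
  unfold symbol; positivity

theorem symbol_le (ξ : Fin d → ℝ) : symbol ξ ≤ 4 * d := by
  unfold symbol
  gcongr
  calc _ ≤ ∑ _j : Fin d, (1 : ℝ) := Finset.sum_le_sum fun j _ => Real.sin_sq_le_one _
    _ = d := by simp

theorem charSum_average (hd : 1 ≤ d) (ξ : Fin d → ℝ) (f : Ell1 d) :
    charSum ξ (average d f) = ((1 - symbol ξ / (2 * d) : ℝ) : ℂ) * charSum ξ f := by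
  have hd' : (d : ℝ) ≠ 0 := by positivity
  have hterm : ∀ j : Fin d,
      Complex.exp (-(Complex.I * (pairing (Pi.single j (1 : ℤ)) ξ : ℂ))) +
        Complex.exp (-(Complex.I * (pairing (-Pi.single j (1 : ℤ)) ξ : ℂ)))
      = ((2 - 4 * Real.sin (ξ j / 2) ^ 2 : ℝ) : ℂ) := fun j => by
    rw [← Pi.single_neg, pairing_single, pairing_single, Real.sin_sq_eq_half_sub]
    have : 2 - 4 * (1 / 2 - Real.cos (2 * (ξ j / 2)) / 2) = 2 * Real.cos (ξ j) := by
      rw [mul_div_cancel₀ _ (two_ne_zero' ℝ)]; ring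
    rw [this]
    push_cast
    rw [Complex.two_cos, add_comm]
    congr 2 <;> ring
  have hsum : 1 - symbol ξ / (2 * d)
      = (2 * d : ℝ)⁻¹ * ∑ j : Fin d, (2 - 4 * Real.sin (ξ j / 2) ^ 2) := by
    rw [Finset.sum_sub_distrib, ← Finset.mul_sum, symbol]
    simp
    field_simp
  rw [hsum, average]
  simp only [FunLike.coe_smul, Pi.smul_apply, map_smul, smul_eq_mul, FunLike.coe_sum,
    Finset.sum_apply, map_sum, FunLike.coe_add, Pi.add_apply, map_add, charSum_translate,
    ← add_mul, hterm, ← Finset.sum_mul]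
  push_cast
  ring

/-- `(-Δ)^s` as a bounded operator on `ℓ¹(ℤᵈ)`. -/
def fracOp (d : ℕ) (s : ℝ) : Ell1 d →L[ℂ] Ell1 d :=
  (((2 * d : ℝ) ^ s : ℝ) : ℂ) • (1 - subordinate s (average d))

/-- The semigroup `e^{-t(-Δ)^s}` on `ℓ¹(ℤᵈ)`. -/
def semigroup (d : ℕ) (s t : ℝ) : Ell1 d →L[ℂ] Ell1 d :=
  NormedSpace.exp ((t : ℂ) • -fracOp d s)

/-! ### Symbols of the operator and semigroup, and the translation estimate -/

variable {s t : ℝ}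

theorem charSum_fracOp (hd : 1 ≤ d) (hs0 : 0 < s) (hs1 : s ≤ 1) (ξ : Fin d → ℝ) (f : Ell1 d) :
    charSum ξ (fracOp d s f) = ((symbol ξ ^ s : ℝ) : ℂ) * charSum ξ f := by
  have hd' : (0 : ℝ) < d := by exact_mod_cast hd
  -- The range `0 ≤ ω ≤ 4d` puts the symbol of `P` exactly in the closed interval of convergence.
  have hx : |1 - symbol ξ / (2 * d)| ≤ 1 := by
    have h1 : 0 ≤ symbol ξ / (2 * d) := div_nonneg (symbol_nonneg ξ) (by positivity)
    have h2 : symbol ξ / (2 * d) ≤ 2 := by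
      rw [div_le_iff₀ (by positivity)]; linarith [symbol_le ξ]
    rw [abs_le]; constructor <;> linarith
  have h := eigenfunctional_subordinate hs0 hs1 (norm_average_le hd) hx (charSum_average hd ξ) f
  rw [fracOp]
  simp only [FunLike.coe_smul, Pi.smul_apply, map_smul, smul_eq_mul, FunLike.coe_sub,
    Pi.sub_apply, map_sub, h, one_apply_eq_self]
  have hp : symbol ξ ^ s = (2 * d : ℝ) ^ s * (symbol ξ / (2 * d)) ^ s := by
    rw [← Real.mul_rpow (by positivity) (div_nonneg (symbol_nonneg ξ) (by positivity)),
      mul_div_cancel₀ _ (by positivity)]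
  rw [hp, sub_sub_cancel]
  push_cast
  ring

theorem charSum_semigroup (hd : 1 ≤ d) (hs0 : 0 < s) (hs1 : s ≤ 1) (t : ℝ) (ξ : Fin d → ℝ)
    (f : Ell1 d) :
    charSum ξ (semigroup d s t f) = ((Real.exp (-t * symbol ξ ^ s) : ℝ) : ℂ) * charSum ξ f := by
  rw [semigroup, eigenfunctional_exp (m := ((-t * symbol ξ ^ s : ℝ) : ℂ)), Complex.ofReal_exp]
  intro g
  simp only [FunLike.coe_smul, Pi.smul_apply, map_smul, smul_eq_mul, FunLike.coe_neg,
    Pi.neg_apply, map_neg, charSum_fracOp hd hs0 hs1]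
  push_cast
  ring

theorem semigroup_add (d : ℕ) (s t r : ℝ) :
    semigroup d s (t + r) = semigroup d s t * semigroup d s r := by
  rw [semigroup, semigroup, semigroup, ← exp_add_eq_mul_of_commute
    (((Commute.refl _).smul_left _).smul_right _), ← add_smul]
  push_cast
  rfl

theorem norm_semigroup_le (hd : 1 ≤ d) (hs0 : 0 < s) (hs1 : s ≤ 1) (ht : 0 ≤ t) :
    ‖semigroup d s t‖ ≤ 1 := by
  have h := norm_exp_smul_sub_le_one (t := t * (2 * d : ℝ) ^ s)
    (norm_subordinate_le_one hs0.le hs1 (norm_average_le hd)) (by positivity)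
  have heq : (t : ℂ) • -fracOp d s = ((t * (2 * d : ℝ) ^ s : ℝ) : ℂ) •
      (subordinate s (average d) - ((1 : ℝ) : ℂ) • 1) := by
    rw [fracOp]
    push_cast
    module
  rwa [semigroup, heq]

theorem commute_translate_fracOp (hd : 1 ≤ d) (hs0 : 0 < s) (hs1 : s ≤ 1) (y : Fin d → ℤ) :
    Commute (translate y) (fracOp d s) :=
  ((Commute.one_right _).sub_right (commute_subordinate hs0.le hs1 (norm_average_le hd)
    (commute_translate_average y))).smul_right _

/-- A share `s/(2d)` of `Q` is the translation itself. Its Poisson semigroup smooths at rate `1/√r`,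
and the commuting remainder only contracts. -/
theorem norm_one_sub_translate_single_mul_semigroup_le (hs0 : 0 < s) (hs1 : s ≤ 1) (ht : 0 < t)
    (j : Fin d) :
    ‖(1 - translate (Pi.single j 1)) * semigroup d s t‖
      ≤ 1 / Real.sqrt (t * ((2 * d : ℝ) ^ s * (s * (2 * d : ℝ)⁻¹))) := by
  have hd : 1 ≤ d := Fin.pos j
  have hd' : (0 : ℝ) < d := by exact_mod_cast hd
  set T := translate (Pi.single j (1 : ℤ)) with hT
  set Q := subordinate s (average d) with hQ
  set c := (2 * d : ℝ)⁻¹ with hc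
  set a := (2 * d : ℝ) ^ s with ha
  have hc0 : 0 < c := by positivity
  have ha0 : 0 < a := by positivity
  have hS : ‖Q - ((s * c : ℝ) : ℂ) • T‖ ≤ 1 - s * c := by
    have h1 := norm_subordinate_sub_le hs0.le hs1 (norm_average_le hd)
    have h2 := norm_average_sub_le j
    have h3 : Q - ((s * c : ℝ) : ℂ) • T
        = (Q - (s : ℂ) • average d) + (s : ℂ) • (average d - (c : ℂ) • T) := by
      push_cast; module
    rw [h3]
    refine (norm_add_le _ _).trans ?_
    rw [norm_smul, Complex.norm_real, Real.norm_of_nonneg hs0.le]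
    have h4 : s * ‖average d - (c : ℂ) • T‖ ≤ s * (1 - c) := by gcongr
    linarith
  -- The weights `sc` and `1 - sc` sum to `1`, so each part is compensated by its own multiple of
  -- the identity.
  have hsplit : (t : ℂ) • -fracOp d s
      = ((t * (a * (s * c)) : ℝ) : ℂ) • (T - 1)
        + ((t * a : ℝ) : ℂ) • ((Q - ((s * c : ℝ) : ℂ) • T) - ((1 - s * c : ℝ) : ℂ) • 1) := by
    rw [fracOp, ← hQ, ← ha]
    push_cast
    module
  have hTQ : Commute T Q := commute_subordinate hs0.le hs1 (norm_average_le hd)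
    (commute_translate_average _)
  have hcomm : Commute (((t * (a * (s * c)) : ℝ) : ℂ) • (T - 1))
      (((t * a : ℝ) : ℂ) • ((Q - ((s * c : ℝ) : ℂ) • T) - ((1 - s * c : ℝ) : ℂ) • 1)) := by
    refine (Commute.smul_right ?_ _).smul_left _
    refine Commute.sub_left ?_ (Commute.one_left _)
    exact (hTQ.sub_right ((Commute.refl T).smul_right _)).sub_right
      ((Commute.one_right _).smul_right _)
  rw [semigroup, hsplit, exp_add_eq_mul_of_commute hcomm, ← mul_assoc]
  refine (norm_mul_le _ _).trans ?_
  refine (mul_le_mul (norm_one_sub_mul_exp_le (norm_translate_le _) (by positivity))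
    (norm_exp_smul_sub_le_one hS (by positivity)) (norm_nonneg _) (by positivity)).trans ?_
  rw [mul_one]

/-! ### Fourier inversion on the torus -/

section FourierInversion

theorem integral_Icc_exp_int_mul (n : ℤ) :
    ∫ θ in Set.Icc (-Real.pi) Real.pi, Complex.exp (Complex.I * ((n * θ : ℝ) : ℂ))
      = if n = 0 then ((2 * Real.pi : ℝ) : ℂ) else 0 := by
  have hpi : -Real.pi ≤ Real.pi := by linarith [Real.pi_pos]
  rw [integral_Icc_eq_integral_Ioc, ← intervalIntegral.integral_of_le hpi]
  split_ifs with hn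
  · simp [hn]
    ring
  · have hc : Complex.I * (n : ℂ) ≠ 0 := mul_ne_zero Complex.I_ne_zero (by exact_mod_cast hn)
    have := integral_exp_mul_complex (a := -Real.pi) (b := Real.pi) hc
    have h2 : Complex.exp (Complex.I * n * (Real.pi : ℝ))
        = Complex.exp (Complex.I * n * ((-Real.pi : ℝ) : ℂ)) := by
      rw [Complex.exp_eq_exp_iff_exists_int]
      exact ⟨n, by push_cast; ring⟩
    rw [h2, sub_self, zero_div] at this
    rw [← this]
    refine intervalIntegral.integral_congr fun θ _ => ?_
    push_cast
    rw [mul_assoc]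

theorem integral_torus_exp_pairing (n : Fin d → ℤ) :
    ∫ ξ in torus d, Complex.exp (Complex.I * (pairing n ξ : ℂ))
      = if n = 0 then (((2 * Real.pi) ^ d : ℝ) : ℂ) else 0 := by
  have h1 : ∀ ξ : Fin d → ℝ, Complex.exp (Complex.I * (pairing n ξ : ℂ))
      = ∏ j, Complex.exp (Complex.I * ((n j * ξ j : ℝ) : ℂ)) := fun ξ => by
    rw [← Complex.exp_sum, ← Finset.mul_sum, pairing]
    push_cast
    rfl
  simp_rw [h1]
  rw [torus, ← Set.pi_univ_Icc, volume_pi, Measure.restrict_pi_pi,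
    integral_fintype_prod_eq_prod
      (f := fun j (θ : ℝ) => Complex.exp (Complex.I * ((n j * θ : ℝ) : ℂ)))]
  simp_rw [integral_Icc_exp_int_mul]
  split_ifs with hn
  · simp [hn]
  · obtain ⟨j, hj⟩ := Function.ne_iff.1 hn
    exact Finset.prod_eq_zero (Finset.mem_univ j) (if_neg hj)

theorem continuous_pairing (x : Fin d → ℤ) : Continuous fun ξ : Fin d → ℝ => pairing x ξ := by
  unfold pairing; fun_prop

theorem continuous_symbol : Continuous fun ξ : Fin d → ℝ => symbol ξ := by
  unfold symbol; fun_prop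

theorem pairing_sub (x y : Fin d → ℤ) (ξ : Fin d → ℝ) :
    pairing (x - y) ξ = pairing x ξ - pairing y ξ := by
  simp [pairing, sub_mul, Finset.sum_sub_distrib]

theorem integral_charSum_mul_exp (f : Ell1 d) (x : Fin d → ℤ) :
    ∫ ξ in torus d, charSum ξ f * Complex.exp (Complex.I * (pairing x ξ : ℂ))
      = (((2 * Real.pi) ^ d : ℝ) : ℂ) * f x := by
  have hF : ∀ (y : Fin d → ℤ) (ξ : Fin d → ℝ),
      f y * Complex.exp (-(Complex.I * (pairing y ξ : ℂ))) *
        Complex.exp (Complex.I * (pairing x ξ : ℂ))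
      = f y * Complex.exp (Complex.I * (pairing (x - y) ξ : ℂ)) := fun y ξ => by
    rw [mul_assoc, ← Complex.exp_add, pairing_sub]
    push_cast
    congr 2
    ring
  have hnorm : ∀ (y : Fin d → ℤ) (ξ : Fin d → ℝ),
      ‖f y * Complex.exp (Complex.I * (pairing (x - y) ξ : ℂ))‖ = ‖f y‖ := fun y ξ => by
    rw [norm_mul, Complex.norm_exp]; simp
  have hint : ∀ y : Fin d → ℤ, IntegrableOn
      (fun ξ => f y * Complex.exp (Complex.I * (pairing (x - y) ξ : ℂ))) (torus d) := fun y => by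
    refine ContinuousOn.integrableOn_compact isCompact_Icc (Continuous.continuousOn ?_)
    have := continuous_pairing (x - y)
    fun_prop
  -- Absolute summability of `f` on a torus of finite volume lets sum and integral be exchanged;
  -- orthogonality then keeps only `y = x`.
  have hsum := hasSum_integral_of_summable_integral_norm (μ := volume.restrict (torus d)) hint (by
    simp_rw [hnorm, integral_const]
    exact (summable_norm f).const_smul _)
  have hpt : ∀ ξ : Fin d → ℝ, ∑' y, f y * Complex.exp (Complex.I * (pairing (x - y) ξ : ℂ))
      = charSum ξ f * Complex.exp (Complex.I * (pairing x ξ : ℂ)) := fun ξ => by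
    simp_rw [← hF, tsum_mul_right, charSum_apply]
  simp_rw [hpt] at hsum
  refine hsum.unique ?_
  simp_rw [integral_const_mul, integral_torus_exp_pairing]
  convert! hasSum_ite_eq x ((((2 * Real.pi) ^ d : ℝ) : ℂ) * f x) using 2 with y
  by_cases h : y = x
  · simp [h, mul_comm]
  · rw [if_neg h, if_neg (fun h' => h (sub_eq_zero.1 h').symm), mul_zero]

theorem fourier_eq (f : Ell1 d) (ξ : Fin d → ℝ) :
    fourier f ξ = (((2 * Real.pi) ^ (-(d : ℝ) / 2) : ℝ) : ℂ) * charSum ξ f := rfl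

theorem two_pi_rpow_mul_self (d : ℕ) :
    ((2 * Real.pi) ^ (-(d : ℝ) / 2) : ℝ) * (2 * Real.pi) ^ (-(d : ℝ) / 2)
      = ((2 * Real.pi) ^ d)⁻¹ := by
  rw [← Real.rpow_add (by positivity), add_halves, Real.rpow_neg (by positivity),
    Real.rpow_natCast]

theorem invFourier_fourier (f : Ell1 d) (x : Fin d → ℤ) :
    invFourier (fourier f) x = f x := by
  have hpi : (((2 * Real.pi) ^ d : ℝ) : ℂ) ≠ 0 := by
    exact_mod_cast (by positivity : ((2 * Real.pi) ^ d : ℝ) ≠ 0)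
  rw [invFourier]
  simp_rw [fourier_eq, mul_assoc]
  rw [integral_const_mul, integral_charSum_mul_exp, ← mul_assoc, ← Complex.ofReal_mul,
    two_pi_rpow_mul_self, ← mul_assoc, Complex.ofReal_inv, inv_mul_cancel₀ hpi, one_mul]

/-- Both sides have the same transform, so inversion identifies the multiplier with the bounded
operator. -/
theorem fracLaplacian_eq (hd : 1 ≤ d) (hs0 : 0 < s) (hs1 : s ≤ 1) (f : Ell1 d) (x : Fin d → ℤ) :
    fracLaplacian s f x = fracOp d s f x := by
  rw [← invFourier_fourier (fracOp d s f), fracLaplacian]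
  congr 1
  funext ξ
  rw [fourier_eq, fourier_eq, charSum_fracOp hd hs0 hs1]
  ring

theorem semigroup_apply_eq (hd : 1 ≤ d) (hs0 : 0 < s) (hs1 : s ≤ 1) (t : ℝ) (f : Ell1 d)
    (x : Fin d → ℤ) :
    semigroup d s t f x = ((((2 * Real.pi) ^ d)⁻¹ : ℝ) : ℂ) *
      ∫ ξ in torus d, ((Real.exp (-t * symbol ξ ^ s) : ℝ) : ℂ) * charSum ξ f *
        Complex.exp (Complex.I * (pairing x ξ : ℂ)) := by
  have hpi : (((2 * Real.pi) ^ d : ℝ) : ℂ) ≠ 0 := by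
    exact_mod_cast (by positivity : ((2 * Real.pi) ^ d : ℝ) ≠ 0)
  simp_rw [← charSum_semigroup hd hs0 hs1 t]
  rw [integral_charSum_mul_exp, ← mul_assoc, Complex.ofReal_inv, inv_mul_cancel₀ hpi, one_mul]

/-- The unit mass at the lattice point `y`. -/
def delta (y : Fin d → ℤ) : Ell1 d := lp.single 1 y 1

theorem delta_apply (y x : Fin d → ℤ) : delta y x = if x = y then 1 else 0 := by
  rw [delta, lp.single_apply, Pi.single_apply]

theorem charSum_delta_zero (ξ : Fin d → ℝ) : charSum ξ (delta 0) = 1 := by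
  rw [charSum_apply, tsum_eq_single 0]
  · simp [delta_apply, pairing]
  · intro x hx
    simp [delta_apply, hx]

theorem heatKernel_eq (hd : 1 ≤ d) (hs0 : 0 < s) (hs1 : s ≤ 1) (t : ℝ) (x : Fin d → ℤ) :
    heatKernel s t x = semigroup d s t (delta 0) x := by
  rw [semigroup_apply_eq hd hs0 hs1, heatKernel]
  simp_rw [charSum_delta_zero, mul_one]

end FourierInversion

/-! ### Existence and uniqueness -/

section CauchyProblem

theorem hasDerivAt_semigroup_apply (f : Ell1 d) (t : ℝ) :
    HasDerivAt (fun t => semigroup d s t f) (-fracOp d s (semigroup d s t f)) t := by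
  have h1 := hasDerivAt_exp_smul_const' (𝕂 := ℂ) (-fracOp d s) (t : ℂ)
  have h2 := (ContinuousLinearMap.apply ℂ (Ell1 d) f).hasFDerivAt.comp_hasDerivAt (t : ℂ) h1
  exact h2.scomp t Complex.ofRealCLM.hasDerivAt |>.congr_deriv (by simp [semigroup])

theorem semigroup_zero : semigroup d s 0 = 1 := by
  simp [semigroup]

theorem isSolution_semigroup (hd : 1 ≤ d) (hs0 : 0 < s) (hs1 : s ≤ 1) (u₀ : Ell1 d) :
    IsSolution s u₀ fun t => semigroup d s t u₀ where
  initial := by simp [semigroup_zero]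
  continuousOn := fun t _ => (hasDerivAt_semigroup_apply u₀ t).continuousAt.continuousWithinAt
  equation := fun t _ => ⟨_, hasDerivAt_semigroup_apply u₀ t, fun x => by
    rw [fracLaplacian_eq hd hs0 hs1]
    simp⟩

theorem IsSolution.hasDerivAt (hd : 1 ≤ d) (hs0 : 0 < s) (hs1 : s ≤ 1) {u₀ : Ell1 d}
    {u : ℝ → Ell1 d} (hu : IsSolution s u₀ u) (ht : 0 < t) :
    HasDerivAt u (-fracOp d s (u t)) t := by
  obtain ⟨v, hv, hvx⟩ := hu.equation t ht
  have : v = -fracOp d s (u t) := by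
    ext x
    have h := hvx x
    rw [fracLaplacian_eq hd hs0 hs1] at h
    simpa using eq_neg_of_add_eq_zero_left h
  rwa [← this]

theorem IsSolution.unique (hd : 1 ≤ d) (hs0 : 0 < s) (hs1 : s ≤ 1) {u₀ : Ell1 d}
    {u v : ℝ → Ell1 d} (hu : IsSolution s u₀ u) (hv : IsSolution s u₀ v) (ht : 0 ≤ t) :
    u t = v t := by
  rcases ht.eq_or_lt with rfl | ht
  · rw [hu.initial, hv.initial]
  have hlip : ∀ _ : ℝ, LipschitzWith ‖-fracOp d s‖₊ fun f : Ell1 d => -fracOp d s f :=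
    fun _ => (-fracOp d s).lipschitz
  -- The equation is only assumed for positive times, so Grönwall starts at `ε > 0`; continuity at
  -- `0` then allows `ε → 0`.
  have hbound : ∀ ε ∈ Set.Ioo 0 t,
      dist (u t) (v t) ≤ dist (u ε) (v ε) * Real.exp (‖-fracOp d s‖₊ * (t - ε)) := fun ε hε => by
    have hsub : Set.Icc ε t ⊆ Set.Ici 0 := fun r hr => hε.1.le.trans hr.1
    exact dist_le_of_trajectories_ODE hlip (hu.continuousOn.mono hsub)
      (fun r hr => (hu.hasDerivAt hd hs0 hs1 (hε.1.trans_le hr.1)).hasDerivWithinAt)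
      (hv.continuousOn.mono hsub)
      (fun r hr => (hv.hasDerivAt hd hs0 hs1 (hε.1.trans_le hr.1)).hasDerivWithinAt)
      le_rfl t ⟨hε.2.le, le_rfl⟩
  have hlim : ∀ {w : ℝ → Ell1 d}, IsSolution s u₀ w → Tendsto w (𝓝[>] 0) (𝓝 u₀) := fun {w} hw => by
    have := (hw.continuousOn 0 Set.self_mem_Ici).tendsto
    rw [hw.initial] at this
    exact this.mono_left (nhdsWithin_mono _ Set.Ioi_subset_Ici_self)
  have hexp : Tendsto (fun ε : ℝ => Real.exp (‖-fracOp d s‖₊ * (t - ε))) (𝓝[>] 0)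
      (𝓝 (Real.exp (‖-fracOp d s‖₊ * (t - 0)))) :=
    (Continuous.tendsto (by fun_prop) 0).mono_left nhdsWithin_le_nhds
  have h0 := ((hlim hu).dist (hlim hv)).mul hexp
  rw [dist_self, zero_mul] at h0
  refine dist_le_zero.1 (ge_of_tendsto h0 ?_)
  filter_upwards [Ioo_mem_nhdsGT ht] with ε hε using hbound ε hε

end CauchyProblem

/-! ### Asymptotic translation invariance and `ℓ¹` convergence -/

section MassConvergence

theorem commute_translate_semigroup (hd : 1 ≤ d) (hs0 : 0 < s) (hs1 : s ≤ 1) (y : Fin d → ℤ)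
    (t : ℝ) : Commute (translate y) (semigroup d s t) := by
  have h := ((commute_translate_fracOp hd hs0 hs1 y).neg_right).smul_right (t : ℂ)
  exact h.exp_right

/-- The lattice vectors along which translation is asymptotically invisible to the semigroup. -/
def asymptoticPeriods (d : ℕ) (s : ℝ) : AddSubgroup (Fin d → ℤ) where
  carrier := {y | Tendsto (fun t => ‖(1 - translate y) * semigroup d s t‖) atTop (𝓝 0)}
  zero_mem' := by simp [translate_zero]
  add_mem' := fun {y z} hy hz => by
    have h := hy.add hz
    rw [add_zero] at h
    refine squeeze_zero (fun _ => norm_nonneg _) (fun t => ?_) h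
    have heq : (1 - translate (y + z)) * semigroup d s t
        = (1 - translate y) * semigroup d s t
          + translate y * ((1 - translate z) * semigroup d s t) := by
      rw [translate_add]; noncomm_ring
    rw [heq]
    refine (norm_add_le _ _).trans (add_le_add le_rfl ((norm_mul_le _ _).trans ?_))
    exact mul_le_of_le_one_left (norm_nonneg _) (norm_translate_le _)
  neg_mem' := fun {y} hy => by
    refine squeeze_zero (fun _ => norm_nonneg _) (fun t => ?_) hy
    have h0 : translate (-y) * translate y = 1 := by
      rw [← translate_add, neg_add_cancel, translate_zero]
    have heq : (1 - translate (-y)) * semigroup d s t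
        = -(translate (-y) * ((1 - translate y) * semigroup d s t)) := by
      rw [← mul_assoc, mul_sub, h0, mul_one, ← neg_mul, neg_sub]
    rw [heq, norm_neg]
    exact (norm_mul_le _ _).trans (mul_le_of_le_one_left (norm_nonneg _) (norm_translate_le _))

theorem single_mem_asymptoticPeriods (hs0 : 0 < s) (hs1 : s ≤ 1) (j : Fin d) :
    Pi.single j 1 ∈ asymptoticPeriods d s := by
  have hd : (0 : ℝ) < d := by exact_mod_cast Fin.pos j
  have hlim : Tendsto
      (fun t : ℝ => 1 / Real.sqrt (t * ((2 * d : ℝ) ^ s * (s * (2 * d : ℝ)⁻¹)))) atTop (𝓝 0) :=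
    (tendsto_const_nhds (x := (1 : ℝ))).div_atTop
      (Real.tendsto_sqrt_atTop.comp (tendsto_id.atTop_mul_const (by positivity)))
  refine squeeze_zero' (Eventually.of_forall fun _ => norm_nonneg _) ?_ hlim
  filter_upwards [eventually_gt_atTop 0] with t ht
  exact norm_one_sub_translate_single_mul_semigroup_le hs0 hs1 ht j

theorem asymptoticPeriods_eq_top (hs0 : 0 < s) (hs1 : s ≤ 1) : asymptoticPeriods d s = ⊤ := by
  refine (AddSubgroup.eq_top_iff' _).2 fun y => ?_
  have : y = ∑ j, y j • Pi.single j (1 : ℤ) := by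
    ext i
    simp [Finset.sum_apply, Pi.single_apply]
  rw [this]
  exact sum_mem fun j _ => zsmul_mem (single_mem_asymptoticPeriods hs0 hs1 j) _

theorem translate_delta_zero (y : Fin d → ℤ) : translate y (delta 0) = delta y := by
  ext x
  simp [delta_apply, sub_eq_zero]

theorem norm_delta (y : Fin d → ℤ) : ‖delta y‖ = 1 := by
  rw [delta, lp.norm_single (by simp)]
  simp

theorem tendsto_norm_semigroup_delta_sub (hd : 1 ≤ d) (hs0 : 0 < s) (hs1 : s ≤ 1)
    (y : Fin d → ℤ) :
    Tendsto (fun t => ‖semigroup d s t (delta y - delta 0)‖) atTop (𝓝 0) := by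
  have hy : y ∈ asymptoticPeriods d s := by rw [asymptoticPeriods_eq_top hs0 hs1]; trivial
  refine squeeze_zero (fun _ => norm_nonneg _) (fun t => ?_) hy
  have hc : Commute (1 - translate y) (semigroup d s t) :=
    (Commute.one_left _).sub_left (commute_translate_semigroup hd hs0 hs1 y t)
  have heq : semigroup d s t (delta y - delta 0)
      = -(((1 - translate y) * semigroup d s t) (delta 0)) := by
    rw [hc.eq, mul_apply_eq_comp, ← map_neg]
    simp [translate_delta_zero]
  rw [heq, norm_neg]
  simpa [norm_delta] using
    ((1 - translate y) * semigroup d s t).le_opNorm (delta (0 : Fin d → ℤ))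

theorem hasSum_smul_delta_sub (f : Ell1 d) :
    HasSum (fun y => f y • (delta y - delta 0)) (f - mass f • delta 0) := by
  have h1 : HasSum (fun y => f y • delta y) f := by
    convert! lp.hasSum_single (by simp) f using 2 with y
    rw [delta, ← lp.single_smul, smul_eq_mul, mul_one]
  have h2 : HasSum (fun y => f y • delta (0 : Fin d → ℤ)) (mass f • delta 0) :=
    (Summable.of_norm (summable_norm f)).hasSum.smul_const _
  simpa only [smul_sub] using h1.sub h2

/-- Each term `u₀(y)(δ_y - δ₀)` decays, and contractivity supplies the summable majorant `2|u₀(y)|`.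
-/
theorem tendsto_norm_semigroup_sub_mass (hd : 1 ≤ d) (hs0 : 0 < s) (hs1 : s ≤ 1) (f : Ell1 d) :
    Tendsto (fun t => ‖semigroup d s t (f - mass f • delta 0)‖) atTop (𝓝 0) := by
  have hs2 : Summable fun y => ‖f y‖ * 2 := (summable_norm f).mul_right 2
  have hbound : ∀ t : ℝ, 0 ≤ t → ∀ y,
      ‖f y‖ * ‖semigroup d s t (delta y - delta 0)‖ ≤ ‖f y‖ * 2 := fun t ht y => by
    gcongr
    refine ((semigroup d s t).le_opNorm _).trans ?_
    refine (mul_le_of_le_one_left (norm_nonneg _) (norm_semigroup_le hd hs0 hs1 ht)).trans ?_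
    refine (norm_sub_le _ _).trans ?_
    rw [norm_delta, norm_delta]
    norm_num
  have hlim : Tendsto (fun t => ∑' y, ‖f y‖ * ‖semigroup d s t (delta y - delta 0)‖) atTop
      (𝓝 (∑' _ : Fin d → ℤ, (0 : ℝ))) := by
    refine tendsto_tsum_of_dominated_convergence hs2 (fun y => ?_) ?_
    · simpa using (tendsto_norm_semigroup_delta_sub hd hs0 hs1 y).const_mul ‖f y‖
    · filter_upwards [eventually_ge_atTop 0] with t ht y
      rw [Real.norm_of_nonneg (by positivity)]
      exact hbound t ht y
  rw [tsum_zero] at hlim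
  refine squeeze_zero' (Eventually.of_forall fun _ => norm_nonneg _) ?_ hlim
  filter_upwards [eventually_ge_atTop 0] with t ht
  rw [← ((semigroup d s t).hasSum (hasSum_smul_delta_sub f)).tsum_eq]
  refine tsum_of_norm_bounded
    (Summable.of_nonneg_of_le (fun y => by positivity) (hbound t ht) hs2).hasSum fun y => ?_
  rw [map_smul, norm_smul]

end MassConvergence

/-! ### The on-diagonal `ℓ¹ → ℓ^∞` bound -/

section Decay

/-- Jordan's inequality `|sin θ| ≥ (2/π)|θ|` for each coordinate suffices, since `‖ξ‖` is the sup
norm. -/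
theorem norm_le_sqrt_symbol {ξ : Fin d → ℝ} (hξ : ξ ∈ torus d) :
    2 / Real.pi * ‖ξ‖ ≤ Real.sqrt (symbol ξ) := by
  have hpi := Real.pi_pos
  rw [← le_div_iff₀' (by positivity), pi_norm_le_iff_of_nonneg (by positivity)]
  intro j
  rw [le_div_iff₀' (by positivity)]
  have hj : |ξ j| ≤ Real.pi := abs_le.2 ⟨hξ.1 j, hξ.2 j⟩
  have h1 := Real.mul_abs_le_abs_sin (x := ξ j / 2) (by rw [abs_div, abs_two]; linarith)
  rw [abs_div, abs_two] at h1
  refine Real.le_sqrt_of_sq_le ?_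
  have h2 : Real.sin (ξ j / 2) ^ 2 ≤ ∑ i, Real.sin (ξ i / 2) ^ 2 :=
    Finset.single_le_sum (f := fun i => Real.sin (ξ i / 2) ^ 2) (fun i _ => sq_nonneg _)
      (Finset.mem_univ j)
  calc (2 / Real.pi * ‖ξ j‖) ^ 2 ≤ (2 * |Real.sin (ξ j / 2)|) ^ 2 := by
        rw [Real.norm_eq_abs]
        gcongr ?_ ^ 2
        linarith
    _ = 4 * Real.sin (ξ j / 2) ^ 2 := by rw [mul_pow, sq_abs]; norm_num
    _ ≤ symbol ξ := by unfold symbol; linarith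

theorem integrable_exp_neg_norm_rpow (hd : 1 ≤ d) {p : ℝ} (hp : 0 < p) :
    Integrable fun η : Fin d → ℝ => Real.exp (-‖η‖ ^ p) := by
  have : Nonempty (Fin d) := ⟨⟨0, hd⟩⟩
  rw [integrable_fun_norm_addHaar volume (f := fun r : ℝ => Real.exp (-r ^ p))]
  have h := integrableOn_rpow_mul_exp_neg_mul_rpow (p := p) (s := ((d - 1 : ℕ) : ℝ)) (b := 1)
    (by linarith [(Nat.cast_nonneg (d - 1) : (0 : ℝ) ≤ ((d - 1 : ℕ) : ℝ))]) hp one_pos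
  simpa [Real.rpow_natCast] using h

/-- The constant in the on-diagonal heat kernel bound. -/
def decayConst (d : ℕ) (s : ℝ) : ℝ :=
  ((2 / Real.pi) ^ d)⁻¹ * ∫ η : Fin d → ℝ, Real.exp (-‖η‖ ^ (2 * s))

theorem integral_exp_neg_symbol_le (hd : 1 ≤ d) (hs0 : 0 < s) (ht : 0 < t) :
    ∫ ξ in torus d, Real.exp (-t * symbol ξ ^ s)
      ≤ decayConst d s * t ^ (-((d : ℝ) / (2 * s))) := by
  -- Chosen so that `‖Rξ‖^(2s) = t ((2/π)‖ξ‖)^(2s) ≤ t ω(ξ)^s`; the Jacobian `R^(-d)` produces the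
  -- decay rate.
  set R : ℝ := 2 / Real.pi * t ^ (1 / (2 * s)) with hR
  have hR0 : 0 < R := by have := Real.pi_pos; positivity
  have hint := integrable_exp_neg_norm_rpow hd (p := 2 * s) (by positivity)
  have hintR : Integrable fun ξ : Fin d → ℝ => Real.exp (-‖R • ξ‖ ^ (2 * s)) :=
    hint.comp_smul hR0.ne'
  have hle : ∀ ξ ∈ torus d, Real.exp (-t * symbol ξ ^ s) ≤ Real.exp (-‖R • ξ‖ ^ (2 * s)) :=
    fun ξ hξ => by
    rw [Real.exp_le_exp, neg_mul, neg_le_neg_iff]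
    have h1 : ‖R • ξ‖ = t ^ (1 / (2 * s)) * (2 / Real.pi * ‖ξ‖) := by
      rw [norm_smul, Real.norm_of_nonneg hR0.le, hR]; ring
    have h2 : (t ^ (1 / (2 * s))) ^ (2 * s) = t := by
      rw [← Real.rpow_mul ht.le, one_div_mul_cancel (by positivity), Real.rpow_one]
    have h3 : Real.sqrt (symbol ξ) ^ (2 * s) = symbol ξ ^ s := by
      rw [Real.sqrt_eq_rpow, ← Real.rpow_mul (symbol_nonneg ξ)]
      congr 1; ring
    have hpi := Real.pi_pos
    rw [h1, Real.mul_rpow (by positivity) (by positivity), h2, ← h3]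
    gcongr
    exact norm_le_sqrt_symbol hξ
  calc ∫ ξ in torus d, Real.exp (-t * symbol ξ ^ s)
      ≤ ∫ ξ in torus d, Real.exp (-‖R • ξ‖ ^ (2 * s)) := by
        refine setIntegral_mono_on ?_ hintR.integrableOn measurableSet_Icc hle
        refine ContinuousOn.integrableOn_compact isCompact_Icc (Continuous.continuousOn ?_)
        exact Real.continuous_exp.comp (continuous_const.mul
          (continuous_symbol.rpow_const fun _ => Or.inr hs0.le))
    _ ≤ ∫ ξ : Fin d → ℝ, Real.exp (-‖R • ξ‖ ^ (2 * s)) :=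
        setIntegral_le_integral hintR (Eventually.of_forall fun _ => (Real.exp_pos _).le)
    _ = decayConst d s * t ^ (-((d : ℝ) / (2 * s))) := by
        rw [Measure.integral_comp_smul_of_nonneg volume
          (fun η : Fin d → ℝ => Real.exp (-‖η‖ ^ (2 * s))) R (hR := hR0.le)]
        have h4 : (t ^ (1 / (2 * s))) ^ d = t ^ ((d : ℝ) / (2 * s)) := by
          rw [← Real.rpow_natCast, ← Real.rpow_mul ht.le]
          congr 1; ring
        rw [Module.finrank_fin_fun, decayConst, hR, mul_pow, h4, Real.rpow_neg ht.le, mul_inv,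
          smul_eq_mul]
        ring

theorem norm_semigroup_apply_le (hd : 1 ≤ d) (hs0 : 0 < s) (hs1 : s ≤ 1) (ht : 0 < t)
    (f : Ell1 d) (x : Fin d → ℤ) :
    ‖semigroup d s t f x‖
      ≤ ((2 * Real.pi) ^ d)⁻¹ * (decayConst d s * t ^ (-((d : ℝ) / (2 * s)))) * ‖f‖ := by
  have hpi := Real.pi_pos
  rw [semigroup_apply_eq hd hs0 hs1, norm_mul, Complex.norm_real,
    Real.norm_of_nonneg (by positivity), mul_assoc]
  gcongr
  have hcont : Continuous fun ξ : Fin d → ℝ => Real.exp (-t * symbol ξ ^ s) * ‖f‖ :=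
    (Real.continuous_exp.comp (continuous_const.mul
      (continuous_symbol.rpow_const fun _ => Or.inr hs0.le))).mul continuous_const
  refine (norm_integral_le_of_norm_le
    (hcont.continuousOn.integrableOn_compact isCompact_Icc)
    (Eventually.of_forall fun ξ => ?_)).trans ?_
  · rw [norm_mul, norm_mul, Complex.norm_real, Real.norm_of_nonneg (Real.exp_pos _).le,
      Complex.norm_exp]
    have : (Complex.I * (pairing x ξ : ℂ)).re = 0 := by simp
    rw [this, Real.exp_zero, mul_one]
    gcongr
    exact norm_charSum_le ξ f
  · rw [integral_mul_const]
    gcongr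
    exact integral_exp_neg_symbol_le hd hs0 ht

end Decay

/-! ### Norms and interpolation -/

section Norms

theorem ellNorm_one (f : Ell1 d) : ellNorm 1 f = ENNReal.ofReal ‖f‖ := by
  rw [ellNorm, eLpNorm_one_eq_lintegral_enorm, lintegral_count, norm_eq_tsum,
    ENNReal.ofReal_tsum_of_nonneg (fun _ => norm_nonneg _) (summable_norm f)]
  simp_rw [ofReal_norm]

theorem ellNorm_top_le {f : (Fin d → ℤ) → ℂ} {C : ℝ} (hC : ∀ x, ‖f x‖ ≤ C) :
    ellNorm ∞ f ≤ ENNReal.ofReal C := by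
  rw [ellNorm, eLpNorm_exponent_top]
  exact eLpNormEssSup_le_of_ae_bound (Eventually.of_forall hC)

/-- For finite `p`, integrate `|f|^p ≤ |f| ‖f‖_∞^(p-1)`. -/
theorem eLpNorm_le_interpolate {α E : Type*} [MeasurableSpace α] {μ : Measure α}
    [NormedAddCommGroup E] {f : α → E} (hf : AEStronglyMeasurable f μ) {p : ℝ≥0∞} (hp : 1 ≤ p) :
    eLpNorm f p μ
      ≤ eLpNorm f 1 μ ^ (p⁻¹).toReal * eLpNorm f ∞ μ ^ (1 - (p⁻¹).toReal) := by
  rcases eq_or_ne p ∞ with rfl | hpt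
  · simp
  have hp0 : p ≠ 0 := (zero_lt_one.trans_le hp).ne'
  have hp1 : 1 ≤ p.toReal := by
    rw [← ENNReal.toReal_one]; exact ENNReal.toReal_mono hpt hp
  have hpp : 0 < p.toReal := by linarith
  rw [eLpNorm_eq_lintegral_rpow_enorm_toReal hp0 hpt, eLpNorm_one_eq_lintegral_enorm,
    eLpNorm_exponent_top, ENNReal.toReal_inv, one_div]
  have hle : ∫⁻ x, ‖f x‖ₑ ^ p.toReal ∂μ
      ≤ (∫⁻ x, ‖f x‖ₑ ∂μ) * eLpNormEssSup f μ ^ (p.toReal - 1) := by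
    rw [← lintegral_mul_const'' _ hf.enorm]
    refine lintegral_mono_ae ?_
    filter_upwards [enorm_ae_le_eLpNormEssSup f μ] with x hx
    calc ‖f x‖ₑ ^ p.toReal = ‖f x‖ₑ ^ (1 + (p.toReal - 1)) := by rw [add_sub_cancel]
      _ = ‖f x‖ₑ * ‖f x‖ₑ ^ (p.toReal - 1) := by
        rw [ENNReal.rpow_add_of_nonneg _ _ zero_le_one (by linarith), ENNReal.rpow_one]
      _ ≤ _ := by gcongr
  calc (∫⁻ x, ‖f x‖ₑ ^ p.toReal ∂μ) ^ p.toReal⁻¹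
      ≤ ((∫⁻ x, ‖f x‖ₑ ∂μ) * eLpNormEssSup f μ ^ (p.toReal - 1)) ^ p.toReal⁻¹ := by gcongr
    _ = _ := by
      rw [ENNReal.mul_rpow_of_nonneg _ _ (by positivity), ← ENNReal.rpow_mul, sub_mul,
        mul_inv_cancel₀ hpp.ne', one_mul]

end Norms

/-! ### Weighted limits for all exponents -/

section Asymptotics

theorem tendsto_ellNorm_one_semigroup_sub_mass (hd : 1 ≤ d) (hs0 : 0 < s) (hs1 : s ≤ 1)
    (f : Ell1 d) :
    Tendsto (fun t : ℝ => ellNorm 1 (semigroup d s t (f - mass f • delta 0))) atTop (𝓝 0) := by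
  simp_rw [ellNorm_one]
  simpa using ENNReal.tendsto_ofReal (tendsto_norm_semigroup_sub_mass hd hs0 hs1 f)

/-- Half the time pays for the kernel decay; the other half stays as an `ℓ¹` norm that can still
tend to zero. -/
theorem rpow_mul_norm_semigroup_apply_le (hd : 1 ≤ d) (hs0 : 0 < s) (hs1 : s ≤ 1) (ht : 0 < t)
    (f : Ell1 d) (x : Fin d → ℤ) :
    t ^ ((d : ℝ) / (2 * s)) * ‖semigroup d s t f x‖
      ≤ ((2 * Real.pi) ^ d)⁻¹ * decayConst d s * 2 ^ ((d : ℝ) / (2 * s)) *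
        ‖semigroup d s (t / 2) f‖ := by
  have h := norm_semigroup_apply_le hd hs0 hs1 (half_pos ht) (semigroup d s (t / 2) f) x
  rw [← mul_apply_eq_comp, ← semigroup_add, add_halves] at h
  have hts : t ^ ((d : ℝ) / (2 * s)) * (t / 2) ^ (-((d : ℝ) / (2 * s)))
      = 2 ^ ((d : ℝ) / (2 * s)) := by
    rw [Real.rpow_neg (by positivity), Real.div_rpow ht.le zero_le_two, inv_div]
    have := (Real.rpow_pos_of_pos ht ((d : ℝ) / (2 * s))).ne'
    field_simp
  calc _ ≤ t ^ ((d : ℝ) / (2 * s)) * (((2 * Real.pi) ^ d)⁻¹ *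
        (decayConst d s * (t / 2) ^ (-((d : ℝ) / (2 * s)))) * ‖semigroup d s (t / 2) f‖) := by
        gcongr
    _ = _ := by rw [← hts]; ring

theorem tendsto_ellNorm_top_semigroup_sub_mass (hd : 1 ≤ d) (hs0 : 0 < s) (hs1 : s ≤ 1)
    (f : Ell1 d) :
    Tendsto (fun t : ℝ => ENNReal.ofReal (t ^ ((d : ℝ) / (2 * s))) *
      ellNorm ∞ (semigroup d s t (f - mass f • delta 0))) atTop (𝓝 0) := by
  have hlim := ((tendsto_norm_semigroup_sub_mass hd hs0 hs1 f).comp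
    (tendsto_id.atTop_div_const (zero_lt_two' ℝ))).const_mul
    (((2 * Real.pi) ^ d)⁻¹ * decayConst d s * 2 ^ ((d : ℝ) / (2 * s)))
  rw [mul_zero] at hlim
  have hlim' := ENNReal.tendsto_ofReal hlim
  rw [ENNReal.ofReal_zero] at hlim'
  refine tendsto_of_tendsto_of_tendsto_of_le_of_le' tendsto_const_nhds hlim'
    (Eventually.of_forall fun _ => zero_le) ?_
  filter_upwards [eventually_gt_atTop 0] with t ht
  have ha : 0 < t ^ ((d : ℝ) / (2 * s)) := Real.rpow_pos_of_pos ht _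
  have hsup := ellNorm_top_le fun x => (le_div_iff₀' ha).2
    (rpow_mul_norm_semigroup_apply_le hd hs0 hs1 ht (f - mass f • delta 0) x)
  refine (mul_le_mul_right hsup _).trans ?_
  rw [← ENNReal.ofReal_mul ha.le, mul_div_cancel₀ _ ha.ne']
  rfl

theorem tendsto_mul_ellNorm_of_endpoints {a : ℝ} {f : ℝ → (Fin d → ℤ) → ℂ} {p : ℝ≥0∞}
    (hp : 1 ≤ p) (h1 : Tendsto (fun t => ellNorm 1 (f t)) atTop (𝓝 0))
    (htop : Tendsto (fun t => ENNReal.ofReal (t ^ a) * ellNorm ∞ (f t)) atTop (𝓝 0)) :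
    Tendsto (fun t : ℝ => ENNReal.ofReal (t ^ (a * (1 - (p⁻¹).toReal))) * ellNorm p (f t))
      atTop (𝓝 0) := by
  set q := (p⁻¹).toReal with hq
  have hq0 : 0 ≤ q := ENNReal.toReal_nonneg
  have hq1 : 0 ≤ 1 - q := by
    have : q ≤ (1 : ℝ≥0∞).toReal :=
      ENNReal.toReal_mono ENNReal.one_ne_top (ENNReal.inv_le_one.2 hp)
    rw [ENNReal.toReal_one] at this
    linarith
  -- At `q = 0` or `q = 1` one factor is `0^0 = 1`; the exponents sum to `1`, so the product still
  -- vanishes.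
  have hz : (0 : ℝ≥0∞) ^ q * 0 ^ (1 - q) = 0 := by
    rw [← ENNReal.rpow_add_of_nonneg _ _ hq0 hq1, add_sub_cancel, ENNReal.rpow_one]
  have hlim := ENNReal.Tendsto.mul
    ((ENNReal.continuous_rpow_const (y := q)).tendsto 0 |>.comp h1)
    (Or.inr (ENNReal.rpow_ne_top_of_nonneg hq1 ENNReal.zero_ne_top))
    ((ENNReal.continuous_rpow_const (y := 1 - q)).tendsto 0 |>.comp htop)
    (Or.inr (ENNReal.rpow_ne_top_of_nonneg hq0 ENNReal.zero_ne_top))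
  rw [hz] at hlim
  refine tendsto_of_tendsto_of_tendsto_of_le_of_le' tendsto_const_nhds hlim
    (Eventually.of_forall fun _ => zero_le) ?_
  filter_upwards [eventually_gt_atTop 0] with t ht
  have hmeas : AEStronglyMeasurable (f t) (Measure.count : Measure (Fin d → ℤ)) :=
    (measurable_of_countable _).aestronglyMeasurable
  calc ENNReal.ofReal (t ^ (a * (1 - q))) * ellNorm p (f t)
      ≤ ENNReal.ofReal (t ^ a) ^ (1 - q) * (ellNorm 1 (f t) ^ q * ellNorm ∞ (f t) ^ (1 - q)) := by
        rw [Real.rpow_mul ht.le, ENNReal.ofReal_rpow_of_nonneg (by positivity) hq1]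
        gcongr
        exact eLpNorm_le_interpolate hmeas hp
    _ = _ := by
        simp only [Function.comp_apply]
        rw [ENNReal.mul_rpow_of_nonneg _ _ hq1]
        ring

end Asymptotics

end LatticeHeat

end

/-! ### The theorem -/

theorem theorem1p7 (d : ℕ) (hd : 1 ≤ d) (s : ℝ) (hs0 : 0 < s) (hs1 : s ≤ 1)
    (u₀ : LatticeHeat.Ell1 d) :
    ∃ u : ℝ → LatticeHeat.Ell1 d,
      -- `u` is the solution of the Cauchy problem: it is one, and there is no other
      LatticeHeat.IsSolution s u₀ u ∧
      (∀ v : ℝ → LatticeHeat.Ell1 d, LatticeHeat.IsSolution s u₀ v →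
        ∀ t : ℝ, 0 ≤ t → v t = u t) ∧
      Tendsto (fun t : ℝ => LatticeHeat.ellNorm 1
          (fun x => u t x - LatticeHeat.mass u₀ * LatticeHeat.heatKernel s t x))
        atTop (𝓝 0) ∧
      Tendsto (fun t : ℝ => ENNReal.ofReal (t ^ ((d : ℝ) / (2 * s))) * LatticeHeat.ellNorm ∞
          (fun x => u t x - LatticeHeat.mass u₀ * LatticeHeat.heatKernel s t x))
        atTop (𝓝 0) ∧
      ∀ p : ℝ≥0∞, 1 ≤ p →
        Tendsto (fun t : ℝ => ENNReal.ofReal (t ^ ((d : ℝ) / (2 * s) * (1 - (p⁻¹).toReal))) *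
            LatticeHeat.ellNorm p
              (fun x => u t x - LatticeHeat.mass u₀ * LatticeHeat.heatKernel s t x))
          atTop (𝓝 0) := by
  have hd' : (0 : ℝ) < d := by exact_mod_cast hd
  -- The kernel is the orbit of `δ₀`, so by linearity the error is the orbit of the zero-mass datum
  -- `u₀ - M δ₀`.
  have hrep : ∀ t : ℝ, (fun x => LatticeHeat.semigroup d s t u₀ x
      - LatticeHeat.mass u₀ * LatticeHeat.heatKernel s t x)
      = LatticeHeat.semigroup d s t (u₀ - LatticeHeat.mass u₀ • LatticeHeat.delta 0) := fun t => by
    funext x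
    rw [LatticeHeat.heatKernel_eq hd hs0 hs1, map_sub, map_smul]
    rfl
  have h1 := LatticeHeat.tendsto_ellNorm_one_semigroup_sub_mass hd hs0 hs1 u₀
  have htop := LatticeHeat.tendsto_ellNorm_top_semigroup_sub_mass hd hs0 hs1 u₀
  refine ⟨fun t => LatticeHeat.semigroup d s t u₀, LatticeHeat.isSolution_semigroup hd hs0 hs1 u₀,
    fun v hv t ht => hv.unique hd hs0 hs1 (LatticeHeat.isSolution_semigroup hd hs0 hs1 u₀) ht, ?_⟩
  simp only [hrep]
  refine ⟨h1, htop, fun p hp => ?_⟩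
  exact LatticeHeat.tendsto_mul_ellNorm_of_endpoints hp h1 htop
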